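/- All graphs are finite and simple. A graph is \emph{$\ell$-chordal} if it has no chordless cycle of length $>\ell$ (a cycle is chordless if every edge of the graph joining two vertices of the cycle is an edge of the cycle). A \emph{separation} of a graph $G$ is a pair $(A,B)$ of vertex sets with $A\cup B=V(G)$ such that $G$ has no edge between $A\setminus B$ and $B\setminus A$; its \emph{order} is $|A\cap B|$. A \emph{$k$-block} of $G$ is a set $X$ of at least $k$ vertices that is inclusion-maximal with the property that for every separation $(A,B)$ of $G$ of order $<k$, either $X\subseteq A$ or $X\subseteq B$. Let $\ell$, $k$ and $t$ be positive integers with $\ell\ge 3$ and $t\ge 2(\ell-2)(k-1)^2$. Then every $\ell$-chordal graph of tree-width $\ge t$ contains a $k$-block. -/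

import Mathlib

namespace SimpleGraph

variable {V : Type*}

/-- A graph is `l`-chordal if it has no chordless cycle of length greater than `l`.
Triangles are chordless. -/
def IsLChordal (G : SimpleGraph V) (l : ℕ) : Prop :=
  ∀ (u : V) (c : G.Walk u u), c.IsCycle → c.IsChordless → c.length ≤ l

/-- A separation of `G`: the two sides cover the vertex set and there is no edge between
`A \ B` and `B \ A`. -/
def IsSeparation (G : SimpleGraph V) (A B : Set V) : Prop :=
  A ∪ B = Set.univ ∧ ∀ a ∈ A \ B, ∀ b ∈ B \ A, ¬ G.Adj a b

/-- No separation of order less than `k` splits `X`: one of its sides contains `X`. -/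
def IsInseparable (G : SimpleGraph V) (k : ℕ) (X : Set V) : Prop :=
  ∀ A B : Set V, G.IsSeparation A B → (A ∩ B).encard < k → X ⊆ A ∨ X ⊆ B

/-- A `k`-block: a set of at least `k` vertices that is inclusion-maximal with the property
that no separation of order less than `k` splits it. -/
def IsBlock (G : SimpleGraph V) (k : ℕ) (X : Set V) : Prop :=
  (k : ℕ∞) ≤ X.encard ∧ Maximal (G.IsInseparable k) X

/-- A tree-decomposition of `G` with underlying tree `T` and parts `bag t`. A connected
induced subgraph of a tree is a subtree; `Connected` includes being non-empty. -/
structure TreeDecomposition (G : SimpleGraph V) {I : Type*} (T : SimpleGraph I) where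
  isTree : T.IsTree
  bag : I → Set V
  connected_induce : ∀ v : V, (T.induce {t | v ∈ bag t}).Connected
  exists_bag_of_adj : ∀ v w : V, G.Adj v w → ∃ t, v ∈ bag t ∧ w ∈ bag t

/-- `G` has a tree-decomposition (over a finite tree) of width at most `w`, that is, all of
whose parts have at most `w + 1` vertices. -/
def HasTreeDecompositionOfWidthLE (G : SimpleGraph V) (w : ℕ) : Prop :=
  ∃ (I : Type) (_ : Finite I) (T : SimpleGraph I) (D : G.TreeDecomposition T),
    ∀ t, (D.bag t).encard ≤ (w + 1 : ℕ)

/-- The tree-width of a finite graph: the least width of a tree-decomposition.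
(The graph without vertices gets the value `0`.) -/
noncomputable def treeWidth (G : SimpleGraph V) : ℕ :=
  sInf {w | G.HasTreeDecompositionOfWidthLE w}

/-- The set in the definition of tree-width is non-empty for finite graphs. -/
theorem exists_hasTreeDecompositionOfWidthLE [Finite V] (G : SimpleGraph V) :
    ∃ w, G.HasTreeDecompositionOfWidthLE w := by
  refine ⟨Nat.card V, Unit, inferInstance, ⊥, ⟨IsTree.of_subsingleton, fun _ => Set.univ, ?_,
    fun _ _ _ => ⟨(), trivial, trivial⟩⟩, fun _ => ?_⟩
  · intro v
    have : Nonempty {t : Unit | v ∈ (Set.univ : Set V)} := ⟨⟨(), trivial⟩⟩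
    exact (IsTree.of_subsingleton).connected
  · rw [Set.encard_univ, ENat.card_eq_coe_natCard]
    exact_mod_cast Nat.le_succ _

end SimpleGraph

/-!
Let `r = k - 1` and suppose that `G` has no `k`-block, so that every set which no separation of
order at most `r` splits has at most `r` vertices.

Large tree-width yields a haven: a family of pairwise intersecting "large" sets, closed under
supersets, such that deleting any `q` vertices leaves a connected large set (`exists_isHaven`; this
costs a factor of three, which the bound on the tree-width can afford). If two vertices are
separated by at most `r` vertices, then one of them is separated from the haven in the same way.
So the set `X` of vertices that cannot be separated from the haven by at most `r` vertices is not
split (`IsHaven.isInseparable`), and has at most `r` elements.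

Every vertex `v` outside `X` has a *guard* of at most `r` vertices separating it, and hence also
all its neighbours, from the haven. Deleting `X` and the guards of the vertices of an induced path
with at most `l - 2` vertices, about `(l - 1) r` vertices altogether, therefore leaves a connected
large set which avoids the closed neighbourhood of the path, no matter how large that neighbourhood
is (`IsHaven.exists_avoiding_path`). In an `l`-chordal graph this is impossible: such a path can be
moved, one vertex at a time, so as to confine the haven to smaller and smaller components, because
all paths that occur stay short for want of long induced cycles (`IsLChordal.false_of_escape`).

The numbers work out with `3 q - 1 ≤ 2 (l - 2) r ^ 2` except when `r ≤ 1` or `l = 3`, `r = 2`. In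
these cases adjacent vertices, or the vertices of a triangle, already form an unsplit set, so `G` is
a forest and has tree-width at most one.
-/

namespace SimpleGraph

variable {V : Type*} {G : SimpleGraph V}

/-! ### Disjoint sums of forests -/

lemma Connected.induce_image {I J : Type*} {T : SimpleGraph I} {T' : SimpleGraph J} {s : Set I}
    (h : (T.induce s).Connected) (f : T ↪g T') : (T'.induce (f '' s)).Connected := by
  let g : T.induce s →g T'.induce (f '' s) :=
    ⟨fun x => ⟨f x, x, x.2, rfl⟩, fun {a b} hab => by simpa using hab⟩
  refine h.map g ?_
  rintro ⟨_, x, hx, rfl⟩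
  exact ⟨⟨x, hx⟩, rfl⟩

lemma Reachable.of_sum_inl {I J : Type*} {T : SimpleGraph I} {T' : SimpleGraph J} {a b : I}
    (h : (T ⊕g T').Reachable (.inl a) (.inl b)) : T.Reachable a b := by
  have key : ∀ {x y : I ⊕ J}, (T ⊕g T').Walk x y → ∀ b, y = .inl b →
      ∃ a, x = .inl a ∧ T.Reachable a b := by
    intro x y p
    induction p with
    | nil => exact fun b hb => ⟨b, hb, .rfl⟩
    | @cons x z y hxz p ih =>
      intro b hb
      obtain ⟨a, rfl, ha⟩ := ih b hb
      rcases x with x | x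
      · exact ⟨x, rfl, (Adj.reachable (by simpa using hxz)).trans ha⟩
      · simp at hxz
  obtain ⟨p⟩ := h
  obtain ⟨a', ha', h'⟩ := key p b rfl
  exact Sum.inl_injective ha' ▸ h'

lemma Reachable.of_sum_inr {I J : Type*} {T : SimpleGraph I} {T' : SimpleGraph J} {a b : J}
    (h : (T ⊕g T').Reachable (.inr a) (.inr b)) : T'.Reachable a b :=
  (h.map (Iso.sumComm (G := T) (H := T')).toHom).of_sum_inl

lemma IsAcyclic.sum {I J : Type*} {T : SimpleGraph I} {T' : SimpleGraph J}
    (h : T.IsAcyclic) (h' : T'.IsAcyclic) : (T ⊕g T').IsAcyclic := by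
  rw [isAcyclic_iff_forall_adj_isBridge] at h h' ⊢
  rintro (v | v) (w | w) hvw
  · rw [isBridge_iff]
    intro hr
    refine (isBridge_iff.1 (h (by simpa using hvw))) (Reachable.of_sum_inl (T' := T') ?_)
    refine hr.mono fun x y hxy => ?_
    rcases x with x | x <;> rcases y with y | y <;> simp_all
  · simp at hvw
  · simp at hvw
  · rw [isBridge_iff]
    intro hr
    refine (isBridge_iff.1 (h' (by simpa using hvw))) (Reachable.of_sum_inr (T := T) ?_)
    refine hr.mono fun x y hxy => ?_
    rcases x with x | x <;> rcases y with y | y <;> simp_all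

/-! ### Gluing tree-decompositions -/

/-- The vertices outside `C` with a neighbour in `C`. -/
def extNbhd (G : SimpleGraph V) (C : Set V) : Set V := {v | v ∉ C ∧ ∃ u ∈ C, G.Adj u v}

/-- The subgraph of `G` induced on `U` has a tree-decomposition over a finite tree with a
distinguished node whose part is `R`, all parts having at most `t` vertices. -/
def HasRootedDecomposition (G : SimpleGraph V) (t : ℕ) (U R : Set V) : Prop :=
  ∃ (I : Type) (_ : Finite I) (T : SimpleGraph I) (r : I) (bag : I → Set V),
    T.IsTree ∧ bag r = R ∧ (∀ i, bag i ⊆ U) ∧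
    (∀ v ∈ U, (T.induce {i | v ∈ bag i}).Connected) ∧
    (∀ v ∈ U, ∀ w ∈ U, G.Adj v w → ∃ i, v ∈ bag i ∧ w ∈ bag i) ∧
    ∀ i, (bag i).ncard ≤ t

lemma HasRootedDecomposition.of_ncard_le {t : ℕ} {R : Set V} (h : R.ncard ≤ t) :
    G.HasRootedDecomposition t R R := by
  refine ⟨Unit, inferInstance, ⊥, (), fun _ => R, IsTree.of_subsingleton, rfl,
    fun _ => subset_rfl, fun v hv => ?_, fun v hv w hw _ => ⟨(), hv, hw⟩, fun _ => h⟩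
  have : Nonempty {i : Unit | v ∈ R} := ⟨⟨(), hv⟩⟩
  exact (IsTree.of_subsingleton).connected

/-- Joining the distinguished nodes of two decompositions by an edge gives a decomposition of the
union, provided that the overlap lies in both distinguished parts and every edge lies on one side. -/
lemma HasRootedDecomposition.glue {t : ℕ} {U₁ R₁ U₂ R₂ : Set V}
    (h₁ : G.HasRootedDecomposition t U₁ R₁) (h₂ : G.HasRootedDecomposition t U₂ R₂)
    (hU : U₁ ∩ U₂ ⊆ R₁ ∩ R₂)
    (hadj : ∀ v ∈ U₁, ∀ w ∈ U₂, G.Adj v w → v ∈ U₂ ∨ w ∈ U₁) :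
    G.HasRootedDecomposition t (U₁ ∪ U₂) R₁ := by
  obtain ⟨I, _, T, r, bag, hT, hr, hbag, hc, he, ht⟩ := h₁
  obtain ⟨I', _, T', r', bag', hT', hr', hbag', hc', he', ht'⟩ := h₂
  let S : SimpleGraph (I ⊕ I') := (T ⊕g T') ⊔ edge (.inl r) (.inr r')
  have hle : (T ⊕g T') ≤ S := le_sup_left
  have hl : ∀ s : Set I, (T.induce s).Connected → (S.induce (Sum.inl '' s)).Connected := by
    intro s hs
    have := hs.induce_image (Embedding.sumInl (G := T) (H := T'))
    exact this.mono (fun a b hab => hle hab)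
  have hrr : ∀ s : Set I', (T'.induce s).Connected → (S.induce (Sum.inr '' s)).Connected := by
    intro s hs
    have := hs.induce_image (Embedding.sumInr (G := T) (H := T'))
    exact this.mono (fun a b hab => hle hab)
  refine ⟨I ⊕ I', inferInstance, S, .inl r, Sum.elim bag bag', ⟨?_, ?_⟩, hr, ?_, ?_, ?_, ?_⟩
  · exact hT.connected.sum_sup_edge hT'.connected
  · exact (hT.isAcyclic.sum hT'.isAcyclic).sup_edge_of_not_reachable
      (not_reachable_sum_inl_inr _ _)
  · rintro (i | i)
    · exact (hbag i).trans Set.subset_union_left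
    · exact (hbag' i).trans Set.subset_union_right
  · intro v hv
    have hset : {i | v ∈ Sum.elim bag bag' i} =
        Sum.inl '' {i | v ∈ bag i} ∪ Sum.inr '' {i | v ∈ bag' i} := by
      ext (i | i) <;> simp
    rw [hset]
    by_cases h1 : v ∈ U₁
    · by_cases h2 : v ∈ U₂
      · refine connected_induce_union (v := .inl r) (w := .inr r') (hl _ (hc v h1)).preconnected
          (hrr _ (hc' v h2)).preconnected ⟨r, ?_, rfl⟩ ⟨r', ?_, rfl⟩ (by simp [S, edge])
        · simpa [hr] using (hU ⟨h1, h2⟩).1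
        · simpa [hr'] using (hU ⟨h1, h2⟩).2
      · have : {i | v ∈ bag' i} = ∅ := by
          ext i; simpa using fun h => h2 (hbag' i h)
        rw [this, Set.image_empty, Set.union_empty]
        exact hl _ (hc v h1)
    · have h2 := hv.resolve_left h1
      have : {i | v ∈ bag i} = ∅ := by
        ext i; simpa using fun h => h1 (hbag i h)
      rw [this, Set.image_empty, Set.empty_union]
      exact hrr _ (hc' v h2)
  · have key : ∀ v w, G.Adj v w → (v ∈ U₁ ∧ w ∈ U₁) ∨ (v ∈ U₂ ∧ w ∈ U₂) →
        ∃ i, v ∈ Sum.elim bag bag' i ∧ w ∈ Sum.elim bag bag' i := by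
      rintro v w hvw (⟨h1, h2⟩ | ⟨h1, h2⟩)
      · obtain ⟨i, hi⟩ := he v h1 w h2 hvw
        exact ⟨.inl i, hi⟩
      · obtain ⟨i, hi⟩ := he' v h1 w h2 hvw
        exact ⟨.inr i, hi⟩
    intro v hv w hw hvw
    have a1 := hadj v
    have a2 := hadj w
    have := hvw.symm
    apply key v w hvw
    rcases hv with hv | hv <;> rcases hw with hw | hw
    · tauto
    · rcases a1 hv w hw hvw <;> tauto
    · rcases a2 hw v hv this <;> tauto
    · tauto
  · rintro (i | i)
    · exact ht i
    · exact ht' i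

lemma HasRootedDecomposition.treeWidth_le [Finite V] {t : ℕ} {R : Set V}
    (h : G.HasRootedDecomposition (t + 1) Set.univ R) : G.treeWidth ≤ t := by
  obtain ⟨I, hI, T, r, bag, hT, hr, hbag, hc, he, ht⟩ := h
  refine Nat.sInf_le ⟨I, hI, T, ⟨hT, bag, fun v => hc v trivial,
    fun v w => he v trivial w trivial⟩, fun i => ?_⟩
  rw [← (Set.toFinite (bag i)).cast_ncard_eq]
  exact_mod_cast ht i

/-! ### Components of induced subgraphs -/

/-- A connected set that meets `D` and avoids the neighbourhood of `D` lies in `D`. -/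
lemma Connected.subset_of_disjoint_extNbhd {K D : Set V} (hK : (G.induce K).Connected)
    (hKD : (K ∩ D).Nonempty) (h : ∀ v ∈ G.extNbhd D, v ∉ K) : K ⊆ D := by
  obtain ⟨a, haK, haD⟩ := hKD
  intro b hbK
  by_contra hbD
  obtain ⟨p⟩ := hK.preconnected ⟨a, haK⟩ ⟨b, hbK⟩
  obtain ⟨d, -, hd1, hd2⟩ := p.exists_boundary_dart {x | (x : V) ∈ D} haD hbD
  exact h d.snd ⟨hd2, d.fst, hd1, d.adj⟩ d.snd.2

lemma connected_induce_singleton (v : V) : (G.induce {v}).Connected := by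
  have : Nonempty ({v} : Set V) := ⟨⟨v, rfl⟩⟩
  exact (IsTree.of_subsingleton).connected

/-- `D` is the vertex set of a component of the subgraph of `G` induced on `Z`. -/
structure IsComponentIn (G : SimpleGraph V) (Z D : Set V) : Prop where
  connected : (G.induce D).Connected
  subset : D ⊆ Z
  notMem_of_mem_extNbhd : ∀ v ∈ G.extNbhd D, v ∉ Z

lemma IsComponentIn.nonempty {Z D : Set V} (h : G.IsComponentIn Z D) : D.Nonempty :=
  Set.nonempty_coe_sort.1 h.connected.nonempty

lemma IsComponentIn.subset_of_connected {Z D K : Set V} (h : G.IsComponentIn Z D)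
    (hK : (G.induce K).Connected) (hKZ : K ⊆ Z) (hKD : (K ∩ D).Nonempty) : K ⊆ D :=
  hK.subset_of_disjoint_extNbhd hKD fun v hv hvK => h.notMem_of_mem_extNbhd v hv (hKZ hvK)

lemma IsComponentIn.eq_of_inter_nonempty {Z D D' : Set V} (h : G.IsComponentIn Z D)
    (h' : G.IsComponentIn Z D') (hne : (D ∩ D').Nonempty) : D = D' :=
  (h'.subset_of_connected h.connected h.subset hne).antisymm
    (h.subset_of_connected h'.connected h'.subset (by rwa [Set.inter_comm]))

lemma exists_isComponentIn [Finite V] {Z K : Set V} (hK : (G.induce K).Connected) (hKZ : K ⊆ Z) :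
    ∃ D, G.IsComponentIn Z D ∧ K ⊆ D := by
  obtain ⟨D, hKD, hD⟩ := (Set.toFinite {D : Set V | (G.induce D).Connected ∧ D ⊆ Z}).exists_le_maximal
    (a := K) ⟨hK, hKZ⟩
  refine ⟨D, ⟨hD.prop.1, hD.prop.2, fun v hv hvZ => hv.1 ?_⟩, hKD⟩
  obtain ⟨hvD, u, hu, huv⟩ := hv
  have hc : (G.induce (D ∪ {v})).Connected := connected_induce_union hD.prop.1.preconnected
    (connected_induce_singleton v).preconnected hu rfl huv
  exact hD.le_of_ge (y := D ∪ {v}) ⟨hc, Set.union_subset hD.prop.2 (by simpa using hvZ)⟩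
    Set.subset_union_left (Or.inr rfl)

/-! ### Sets without a small decomposition -/

/-- The subgraph induced on `C` and its neighbourhood has a tree-decomposition with parts of at
most `t` vertices, one of which contains the whole neighbourhood of `C`. -/
def IsDecomposable (G : SimpleGraph V) (t : ℕ) (C : Set V) : Prop :=
  ∃ R, G.extNbhd C ⊆ R ∧ G.HasRootedDecomposition t (C ∪ G.extNbhd C) R

/-- If `B` separates `C` into decomposable components, then `C` is decomposable: attach
decompositions of the components to a node whose part is `B`. -/
lemma isDecomposable_of_components [Finite V] {t : ℕ} {C B : Set V} (hCB : G.extNbhd C ⊆ B)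
    (hB : B ⊆ C ∪ G.extNbhd C) (hBt : B.ncard ≤ t)
    (h : ∀ D, G.IsComponentIn (C \ B) D → G.IsDecomposable t D) : G.IsDecomposable t C := by
  classical
  have hN : ∀ D, G.IsComponentIn (C \ B) D → G.extNbhd D ⊆ B := by
    intro D hD v hv
    have h1 := hD.notMem_of_mem_extNbhd v hv
    obtain ⟨u, hu, huv⟩ := hv.2
    by_cases hvC : v ∈ C
    · by_contra hvB
      exact h1 ⟨hvC, hvB⟩
    · exact hCB ⟨hvC, u, (hD.subset hu).1, huv⟩
  have key : ∀ s : Finset (Set V), (∀ D ∈ s, G.IsComponentIn (C \ B) D) →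
      G.HasRootedDecomposition t (B ∪ ⋃ D ∈ s, D) B := by
    intro s
    induction s using Finset.induction_on with
    | empty => intro _; simpa using HasRootedDecomposition.of_ncard_le hBt
    | insert D s hDs ih =>
      intro hs
      have hD := hs D (Finset.mem_insert_self D s)
      have hs' : ∀ D ∈ s, G.IsComponentIn (C \ B) D :=
        fun D' h' => hs D' (Finset.mem_insert_of_mem h')
      obtain ⟨R, hR, hdec⟩ := h D hD
      have hglue := (ih hs').glue hdec ?_ ?_
      · convert! hglue using 1
        ext v
        have := @hN D hD v
        simp only [Finset.mem_insert, Set.mem_union, Set.mem_iUnion]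
        constructor
        · rintro (h | ⟨E, rfl | hE, hv⟩)
          · tauto
          · tauto
          · exact Or.inl (Or.inr ⟨E, hE, hv⟩)
        · rintro ((h | ⟨E, hE, hv⟩) | h | h)
          · tauto
          · exact Or.inr ⟨E, Or.inr hE, hv⟩
          · exact Or.inr ⟨D, Or.inl rfl, h⟩
          · exact Or.inl (this h)
      · rintro v ⟨hv1, hv2 | hv2⟩
        · exfalso
          rcases hv1 with hv1 | hv1
          · exact (hD.subset hv2).2 hv1
          · simp only [Set.mem_iUnion] at hv1
            obtain ⟨E, hE, hvE⟩ := hv1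
            exact hDs (hD.eq_of_inter_nonempty (hs' E hE) ⟨v, hv2, hvE⟩ ▸ hE)
        · exact ⟨hN D hD hv2, hR hv2⟩
      · rintro v - w (hw | hw) hvw
        · by_cases hvD : v ∈ D
          · exact Or.inl (Or.inl hvD)
          · exact Or.inl (Or.inr ⟨hvD, w, hw, hvw.symm⟩)
        · exact Or.inr (Or.inl (hN D hD hw))
  refine ⟨B, hCB, ?_⟩
  have hfin := Set.toFinite {D | G.IsComponentIn (C \ B) D}
  convert! key hfin.toFinset (by simp) using 1
  ext v
  constructor
  · rintro hv
    by_cases hvB : v ∈ B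
    · exact Or.inl hvB
    · have hvC : v ∈ C := hv.resolve_right fun h => hvB (hCB h)
      obtain ⟨D, hD, hvD⟩ := exists_isComponentIn (Z := C \ B) (connected_induce_singleton (G := G) v)
        (by simpa using ⟨hvC, hvB⟩)
      refine Or.inr ?_
      simp only [Set.mem_iUnion]
      exact ⟨D, by simpa using hD, hvD rfl⟩
  · rintro (hv | hv)
    · exact hB hv
    · simp only [Set.mem_iUnion, Set.Finite.mem_toFinset] at hv
      obtain ⟨D, hD, hvD⟩ := hv
      exact Or.inl (hD.subset hvD).1

/-- A non-decomposable set that is minimal among those with at most `s` neighbours. -/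
lemma exists_minimal_not_isDecomposable [Finite V] {t : ℕ} (s : ℕ)
    (h : t + 1 ≤ G.treeWidth) :
    ∃ C, ¬ G.IsDecomposable (t + 1) C ∧ (G.extNbhd C).ncard ≤ s ∧
      ∀ D ⊂ C, (G.extNbhd D).ncard ≤ s → G.IsDecomposable (t + 1) D := by
  have hempty : G.extNbhd Set.univ = ∅ := by
    ext v; simp [extNbhd]
  have huniv : ¬ G.IsDecomposable (t + 1) Set.univ := by
    rintro ⟨R, -, hR⟩
    rw [Set.univ_union] at hR
    have := hR.treeWidth_le
    omega
  obtain ⟨C, -, hC⟩ := (Set.toFinite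
    {C | ¬ G.IsDecomposable (t + 1) C ∧ (G.extNbhd C).ncard ≤ s}).exists_le_minimal
    (a := Set.univ) ⟨huniv, by simp [hempty]⟩
  refine ⟨C, hC.prop.1, hC.prop.2, fun D hD hDs => ?_⟩
  by_contra hbad
  exact hD.2 (hC.le_of_le ⟨hbad, hDs⟩ hD.1)

/-! ### Havens -/

/-- A haven of order greater than `q`, presented by the sets that contain one of its regions: an
upward closed family of pairwise intersecting sets such that after deleting any at most `q`
vertices some connected set of the family is left. -/
structure IsHaven (G : SimpleGraph V) (q : ℕ) (M : Set (Set V)) : Prop where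
  mono : ∀ K ∈ M, ∀ K', K ⊆ K' → K' ∈ M
  inter_nonempty : ∀ K ∈ M, ∀ K' ∈ M, (K ∩ K').Nonempty
  exists_connected : ∀ Q : Set V, Q.ncard ≤ q → ∃ K ∈ M, (G.induce K).Connected ∧ Disjoint K Q

/-- Adding to a connected set some of its neighbours keeps it connected. -/
lemma Connected.induce_union_of_subset_extNbhd {D W : Set V} (hD : (G.induce D).Connected)
    (hW : W ⊆ G.extNbhd D) : (G.induce (D ∪ W)).Connected := by
  obtain ⟨⟨u, hu⟩⟩ := hD.nonempty
  refine induce_connected_of_patches u (Or.inl hu) ?_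
  rintro v (hv | hv)
  · exact ⟨D, Set.subset_union_left, hu, hv, hD.preconnected _ _⟩
  · obtain ⟨-, w, hw, hwv⟩ := hW hv
    have hc : (G.induce (D ∪ {v})).Connected := connected_induce_union hD.preconnected
      (connected_induce_singleton v).preconnected hw rfl hwv
    exact ⟨D ∪ {v}, Set.union_subset_union_right _ (by simpa using hv), Or.inl hu, Or.inr rfl,
      hc.preconnected _ _⟩

/-- Large tree-width forces a haven. Take a minimal non-decomposable set `C` with at most `2q - 1`
neighbours. Deleting `Q` leaves a non-decomposable component `D` of `C \ Q`, and unless `D = C` it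
has at least `2q` neighbours, so at least `q` of these lie in the neighbourhood of `C`
outside `Q`: more than half of that neighbourhood. -/
theorem exists_isHaven [Finite V] {t q : ℕ} (hq : 1 ≤ q) (hqt : 3 * q ≤ t + 1)
    (h : t ≤ G.treeWidth) : ∃ M, G.IsHaven q M := by
  obtain ⟨t, rfl⟩ : ∃ t', t = t' + 1 := ⟨t - 1, by omega⟩
  obtain ⟨C, hC, hCs, hmin⟩ := exists_minimal_not_isDecomposable (2 * q - 1) h
  have hCne : C.Nonempty := by
    by_contra hne
    rw [Set.not_nonempty_iff_eq_empty] at hne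
    have hN : G.extNbhd ∅ = ∅ := by ext v; simp [extNbhd]
    subst hne
    refine hC ⟨∅, hN.le, ?_⟩
    rw [hN, Set.union_empty]
    exact .of_ncard_le (by simp)
  refine ⟨{K | C ⊆ K ∨ ((K ∩ C).Nonempty ∧ q ≤ (K ∩ G.extNbhd C).ncard)}, ?_, ?_, ?_⟩
  · rintro K (h | ⟨h1, h2⟩) K' hKK'
    · exact Or.inl (h.trans hKK')
    · exact Or.inr ⟨h1.mono (Set.inter_subset_inter_left _ hKK'),
        h2.trans (Set.ncard_le_ncard (Set.inter_subset_inter_left _ hKK'))⟩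
  · rintro K (h | ⟨h1, h2⟩) K' (h' | ⟨h1', h2'⟩)
    · exact hCne.mono (Set.subset_inter h h')
    · rw [Set.inter_comm] at h1' ⊢
      exact h1'.mono fun x hx => ⟨hx.2, h hx.1⟩
    · exact h1.mono fun x hx => ⟨hx.1, h' hx.2⟩
    · by_contra hne
      rw [Set.not_nonempty_iff_eq_empty, ← Set.disjoint_iff_inter_eq_empty] at hne
      have h3 := Set.ncard_union_eq (s := K ∩ G.extNbhd C) (t := K' ∩ G.extNbhd C)
        (hne.mono Set.inter_subset_left Set.inter_subset_left)
      have h4 : (K ∩ G.extNbhd C ∪ K' ∩ G.extNbhd C).ncard ≤ (G.extNbhd C).ncard :=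
        Set.ncard_le_ncard (Set.union_subset Set.inter_subset_right Set.inter_subset_right)
      omega
  · intro Q hQ
    set B := G.extNbhd C ∪ Q ∩ C with hB
    obtain ⟨D, hD, hDbad⟩ : ∃ D, G.IsComponentIn (C \ B) D ∧ ¬ G.IsDecomposable (t + 1) D := by
      by_contra! hall
      refine hC (isDecomposable_of_components (B := B) Set.subset_union_left ?_ ?_ hall)
      · exact Set.union_subset Set.subset_union_right fun x hx => Or.inl hx.2
      · have h1 := Set.ncard_union_le (G.extNbhd C) (Q ∩ C)
        have h2 := Set.ncard_le_ncard (Set.inter_subset_left (s := Q) (t := C))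
        rw [← hB] at h1
        omega
    have hDC : D ⊆ C := hD.subset.trans Set.sdiff_subset
    have hDQ : Disjoint D Q := Set.disjoint_left.2 fun x hx hxQ =>
      (hD.subset hx).2 (Or.inr ⟨hxQ, hDC hx⟩)
    rcases eq_or_ne D C with rfl | hne
    · exact ⟨D, Or.inl subset_rfl, hD.connected, hDQ⟩
    have hDN : 2 * q ≤ (G.extNbhd D).ncard := by
      by_contra hlt
      exact hDbad (hmin D (hDC.ssubset_of_ne hne) (by omega))
    refine ⟨D ∪ (G.extNbhd D \ Q), Or.inr ⟨?_, ?_⟩,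
      hD.connected.induce_union_of_subset_extNbhd Set.sdiff_subset,
      Set.disjoint_union_left.2 ⟨hDQ, Set.disjoint_sdiff_left⟩⟩
    · exact hD.nonempty.mono fun x hx => ⟨Or.inl hx, hDC hx⟩
    · have h1 : G.extNbhd D \ Q ⊆ (D ∪ (G.extNbhd D \ Q)) ∩ G.extNbhd C := by
        intro v hv
        refine ⟨Or.inr hv, fun hvC => ?_, ?_⟩
        · refine hD.notMem_of_mem_extNbhd v hv.1 ⟨hvC, ?_⟩
          rintro (hvB | hvB)
          · exact hvB.1 hvC
          · exact hv.2 hvB.1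
        · obtain ⟨u, hu, huv⟩ := hv.1.2
          exact ⟨u, hDC hu, huv⟩
      have h2 := Set.ncard_le_ncard h1
      have h3 := Set.le_ncard_sdiff Q (G.extNbhd D)
      omega

/-! ### Forests -/

/-- Forests have tree-width at most one. -/
theorem IsAcyclic.treeWidth_le_one [Finite V] (hG : G.IsAcyclic) : G.treeWidth ≤ 1 := by
  by_contra! h
  obtain ⟨C, hC, hCs, hmin⟩ := exists_minimal_not_isDecomposable (t := 1) 1 h
  have hone : ∀ {s : Set V}, s.ncard ≤ 1 → ∀ a ∈ s, ∀ b ∈ s, a = b := by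
    intro s hs
    simpa using (Set.ncard_le_one (Set.toFinite s)).1 hs
  -- a vertex of `C` adjacent to the neighbourhood of `C`, if there is one
  obtain ⟨c, hcC, hc⟩ : ∃ c ∈ C, ∀ w ∈ G.extNbhd C, G.Adj c w := by
    rcases (G.extNbhd C).eq_empty_or_nonempty with he | ⟨w, hw⟩
    · have hCne : C.Nonempty := by
        by_contra hne
        rw [Set.not_nonempty_iff_eq_empty] at hne
        subst hne
        refine hC ⟨∅, he.le, ?_⟩
        rw [he, Set.union_empty]
        exact .of_ncard_le (by simp)
      exact ⟨hCne.some, hCne.some_mem, by simp [he]⟩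
    · obtain ⟨c, hcC, hcw⟩ := hw.2
      exact ⟨c, hcC, fun w' hw' => hone hCs w hw w' hw' ▸ hcw⟩
  refine hC (isDecomposable_of_components (B := G.extNbhd C ∪ {c}) Set.subset_union_left
    (Set.union_subset Set.subset_union_right (by simp [hcC])) ?_ ?_)
  · have := Set.ncard_union_le (G.extNbhd C) {c}
    rw [Set.ncard_singleton] at this
    omega
  intro D hD
  have hDC : D ⊆ C := hD.subset.trans Set.sdiff_subset
  have hcD : c ∉ D := fun hcD => (hD.subset hcD).2 (Or.inr rfl)
  refine hmin D ⟨hDC, fun h => hcD (h hcC)⟩ ?_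
  have hND : ∀ v ∈ G.extNbhd D, v = c ∨ v ∈ G.extNbhd C := by
    intro v hv
    by_contra! hne
    have h1 := hD.notMem_of_mem_extNbhd v hv
    obtain ⟨u, hu, huv⟩ := hv.2
    by_cases hvC : v ∈ C
    · exact h1 ⟨hvC, by simp [hne.1, hne.2]⟩
    · exact hne.2 ⟨hvC, u, hDC hu, huv⟩
  -- if `c` and `w` both had neighbours in `D`, the edge `cw` would lie on a cycle
  have hcyc : ∀ w ∈ G.extNbhd C, c ∈ G.extNbhd D → w ∉ G.extNbhd D := by
    rintro w hw ⟨-, u, hu, huc⟩ ⟨hwD, u', hu', huw⟩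
    have hb := isBridge_iff.1 (isAcyclic_iff_forall_adj_isBridge.1 hG (hc w hw))
    have hmem : ∀ x ∈ D, x ≠ c ∧ x ≠ w := fun x hx => ⟨by rintro rfl; exact hcD hx,
      by rintro rfl; exact hwD hx⟩
    have hadj : ∀ x ∈ D, ∀ y, G.Adj x y → (G.deleteEdges {s(c, w)}).Adj x y := by
      intro x hx y hxy
      have := hmem x hx
      simp [hxy, this.1, this.2]
    let f : G.induce D →g G.deleteEdges {s(c, w)} :=
      ⟨fun x => x, fun {a b} hab => hadj a a.2 b hab⟩
    have hr := (hD.connected.preconnected ⟨u, hu⟩ ⟨u', hu'⟩).map f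
    exact hb (((hadj u hu c huc).symm.reachable.trans hr).trans (hadj u' hu' w huw).reachable)
  rw [Set.ncard_le_one (Set.toFinite _)]
  intro a ha b hb
  rcases hND a ha with rfl | ha' <;> rcases hND b hb with rfl | hb'
  · rfl
  · exact absurd hb (hcyc b hb' ha)
  · exact absurd ha (hcyc a ha' hb)
  · exact hone hCs a ha' b hb'

/-! ### Induced paths and cycles -/

/-- The vertices `p 0, …, p (m - 1)` form, in this order, an induced path of `G`. -/
structure IsInducedPath (G : SimpleGraph V) (p : ℕ → V) (m : ℕ) : Prop where
  ne : ∀ i j, i < j → j < m → p i ≠ p j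
  adj_iff : ∀ i j, i < j → j < m → (G.Adj (p i) (p j) ↔ j = i + 1)

/-- An induced cycle `c 0, …, c (n - 1)` of an `l`-chordal graph has at most `l` vertices. -/
lemma IsLChordal.le_of_induced_cycle {l n : ℕ} (hG : G.IsLChordal l) (hn : 3 ≤ n) (c : ℕ → V)
    (hne : ∀ i j, i < j → j < n → c i ≠ c j)
    (hadj : ∀ i j, i < j → j < n → (G.Adj (c i) (c j) ↔ j = i + 1 ∨ i = 0 ∧ j + 1 = n)) :
    n ≤ l := by
  obtain ⟨n, rfl⟩ : ∃ n', n = n' + 3 := ⟨n - 3, by omega⟩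
  -- adjacency in the cycle graph, for the smaller vertex first
  have hcyc : ∀ i j : Fin (n + 3), i < j →
      ((cycleGraph (n + 3)).Adj i j ↔ j.val = i.val + 1 ∨ i.val = 0 ∧ j.val + 1 = n + 3) := by
    intro i j hij
    rw [cycleGraph_adj', Fin.coe_sub_iff_lt.2 hij, Fin.sub_val_of_le hij.le]
    have := j.2
    omega
  have hiff : ∀ i j : Fin (n + 3), G.Adj (c i) (c j) ↔ (cycleGraph (n + 3)).Adj i j := by
    intro i j
    rcases lt_trichotomy i j with h | rfl | h
    · rw [hadj i j h j.2, hcyc i j h]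
    · simp
    · rw [G.adj_comm, hadj j i h i.2, (cycleGraph (n + 3)).adj_comm, hcyc j i h]
  let f : cycleGraph (n + 3) →g G := ⟨fun i => c i, fun {i j} h => (hiff i j).2 h⟩
  have hf : Function.Injective f := by
    intro i j hij
    rcases lt_trichotomy i j with h | h | h
    · exact absurd hij (hne i j h j.2)
    · exact h
    · exact absurd hij.symm (hne j i h i.2)
  have hedge : ∀ i j : Fin (n + 3), (cycleGraph (n + 3)).Adj i j →
      s(i, j) ∈ (cycleGraph.cycle n).edges := by
    have key : ∀ k : ℕ, k < n + 3 →
        s((cycleGraph.cycle n).getVert k, (cycleGraph.cycle n).getVert (k + 1)) ∈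
          (cycleGraph.cycle n).edges := by
      intro k hk
      exact (Walk.mk_mem_edges_iff_exists _).2 ⟨k, by simpa using hk, rfl⟩
    intro i j hij
    wlog h : i < j generalizing i j
    · rw [Sym2.eq_swap]
      exact this j i hij.symm (lt_of_le_of_ne (not_lt.1 h) hij.ne')
    have hi := i.2
    have hj := j.2
    rcases (hcyc i j h).1 hij with h' | ⟨h0, h'⟩
    · have := key (n + 3 - j) (by omega)
      rw [cycleGraph.getVert_cycle (by omega), cycleGraph.getVert_cycle (by omega)] at this
      rw [Sym2.eq_swap]
      convert! this using 3
      · rw [Nat.mod_eq_of_lt (by omega)]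
        omega
      · rw [Nat.mod_eq_of_lt (by omega)]
        omega
    · have := key 0 (by omega)
      rw [cycleGraph.getVert_cycle (by omega), cycleGraph.getVert_cycle (by omega)] at this
      convert! this using 3
      · simp [h0]
      · rw [Nat.mod_eq_of_lt (by omega)]
        omega
  have hlen := hG _ ((cycleGraph.cycle n).map f)
    ((Walk.isCycle_map_iff_of_injective hf).2 cycleGraph.isCycle_cycle) ?_
  · simpa using hlen
  rw [Walk.isChordless_iff_forall_mem_edges]
  intro a b ha hb hab
  rw [Walk.support_map, List.mem_map] at ha hb
  obtain ⟨i, -, rfl⟩ := ha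
  obtain ⟨j, -, rfl⟩ := hb
  rw [Walk.edges_map, List.mem_map]
  exact ⟨s(i, j), hedge i j ((hiff i j).1 hab), rfl⟩

/-- A shortest path, listed vertex by vertex, is induced. -/
lemma Reachable.exists_induced_path {a b : V} (h : G.Reachable a b) :
    ∃ (d : ℕ) (q : ℕ → V), q 0 = a ∧ q d = b ∧ G.IsInducedPath q (d + 1) := by
  obtain ⟨p, hp⟩ := h.exists_walk_length_eq_dist
  have key : ∀ i j, i ≤ j → j ≤ p.length → ∀ w : G.Walk (p.getVert i) (p.getVert j),
      j ≤ i + w.length := by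
    intro i j hij hj w
    have := G.dist_le ((p.take i).append (w.append (p.drop j)))
    simp only [Walk.length_append, Walk.take_length, Walk.drop_length] at this
    omega
  refine ⟨p.length, p.getVert, p.getVert_zero, p.getVert_length, ?_, ?_⟩
  · intro i j hij hj heq
    have := key i j hij.le (by omega) (Walk.nil.copy rfl heq)
    simp at this
    omega
  · intro i j hij hj
    constructor
    · intro hadj
      have := key i j hij.le (by omega) hadj.toWalk
      simp at this
      omega
    · rintro rfl
      exact p.adj_getVert_succ (by omega)

/-- Two nonadjacent neighbours of a connected set are joined by an induced path through it. -/
lemma Connected.exists_induced_path_through {K : Set V} (hK : (G.induce K).Connected) {u w : V}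
    (hu : u ∈ G.extNbhd K) (hw : w ∈ G.extNbhd K) (hne : u ≠ w) (huw : ¬ G.Adj u w) :
    ∃ (d : ℕ) (q : ℕ → V), 2 ≤ d ∧ q 0 = w ∧ q d = u ∧ (∀ i, 0 < i → i < d → q i ∈ K) ∧
      G.IsInducedPath q (d + 1) := by
  have hc : (G.induce (K ∪ {u, w})).Connected := by
    refine hK.induce_union_of_subset_extNbhd ?_
    rintro x (rfl | rfl) <;> assumption
  let H : SimpleGraph V := (G.induce (K ∪ {u, w})).spanningCoe
  have hH : ∀ x y, H.Adj x y ↔ G.Adj x y ∧ x ∈ K ∪ {u, w} ∧ y ∈ K ∪ {u, w} := by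
    intro x y
    simp [H]
  have hr : H.Reachable w u := by
    let f : G.induce (K ∪ {u, w}) →g H := ⟨fun x => x, fun {a b} hab => (hH a b).2 ⟨hab, a.2, b.2⟩⟩
    exact (hc.preconnected ⟨w, by simp⟩ ⟨u, by simp⟩).map f
  obtain ⟨d, q, h0, hd, hq⟩ := hr.exists_induced_path
  have hd0 : d ≠ 0 := by
    rintro rfl
    exact hne (hd.symm.trans h0)
  have hd1 : d ≠ 1 := by
    rintro rfl
    have := ((hH _ _).1 ((hq.adj_iff 0 1 (by omega) (by omega)).2 rfl)).1
    rw [h0, hd] at this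
    exact huw this.symm
  have hmem : ∀ i, i ≤ d → q i ∈ K ∪ {u, w} := by
    intro i hi
    rcases eq_or_lt_of_le hi with rfl | hi
    · rw [hd]; simp
    · exact ((hH _ _).1 ((hq.adj_iff i (i + 1) (by omega) (by omega)).2 rfl)).2.1
  refine ⟨d, q, by omega, h0, hd, fun i hi hid => ?_, hq.ne, fun i j hij hj => ?_⟩
  · rcases hmem i hid.le with h | h | h
    · exact h
    · exact absurd (h.trans hd.symm) (hq.ne i d hid (by omega))
    · exact absurd (h0.trans h.symm) (hq.ne 0 i hi (by omega))
  · rw [← hq.adj_iff i j hij hj, hH]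
    simp only [hmem i (by omega), hmem j (by omega), and_true]

/-- In an `l`-chordal graph, let a connected set `K` have no neighbour on an induced path with `m`
vertices. If `K` has nonadjacent neighbours `u` and `w` attached only to the first, respectively
only to the last vertex of the path, then the path closes up through `K` to an induced cycle on at
least `m + 3` vertices. -/
lemma IsLChordal.add_three_le {l m : ℕ} (hG : G.IsLChordal l) {p : ℕ → V}
    (hp : G.IsInducedPath p m) (hm : 1 ≤ m) {K : Set V} (hK : (G.induce K).Connected)
    (hpK : ∀ i < m, p i ∉ K ∧ p i ∉ G.extNbhd K) {u w : V} (hu : u ∈ G.extNbhd K)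
    (hw : w ∈ G.extNbhd K) (hne : u ≠ w) (huw : ¬ G.Adj u w)
    (hup : ∀ i < m, (G.Adj (p i) u ↔ i = 0)) (hwp : ∀ i < m, (G.Adj (p i) w ↔ i + 1 = m)) :
    m + 3 ≤ l := by
  obtain ⟨d, q, hd2, h0, hd, hqK, hq⟩ := hK.exists_induced_path_through hu hw hne huw
  have hpq : ∀ i < m, ∀ j ≤ d, p i ≠ q j ∧
      (G.Adj (p i) (q j) ↔ i + 1 = m ∧ j = 0 ∨ i = 0 ∧ j = d) := by
    intro i hi j hj
    rcases Nat.eq_zero_or_pos j with rfl | hj0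
    · rw [h0, hwp i hi]
      exact ⟨fun h => (hpK i hi).2 (h ▸ hw), by omega⟩
    rcases eq_or_lt_of_le hj with rfl | hjd
    · rw [hd, hup i hi]
      exact ⟨fun h => (hpK i hi).2 (h ▸ hu), by omega⟩
    have hjK := hqK j hj0 hjd
    refine ⟨fun h => (hpK i hi).1 (h ▸ hjK), fun h => ?_, by omega⟩
    exact absurd ⟨(hpK i hi).1, q j, hjK, h.symm⟩ (hpK i hi).2
  have hlen : m + d + 1 ≤ l := by
    refine hG.le_of_induced_cycle (by omega) (fun i => if i < m then p i else q (i - m)) ?_ ?_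
    · intro i j hij hj
      by_cases hjm : j < m
      · simpa [hjm, hij.trans hjm] using hp.ne i j hij hjm
      · by_cases him : i < m
        · simpa [hjm, him] using (hpq i him (j - m) (by omega)).1
        · simpa [hjm, him] using hq.ne (i - m) (j - m) (by omega) (by omega)
    · intro i j hij hj
      by_cases hjm : j < m
      · simp only [hjm, hij.trans hjm, if_true, hp.adj_iff i j hij hjm]
        omega
      · by_cases him : i < m
        · simp only [hjm, him, if_true, if_false, (hpq i him (j - m) (by omega)).2]
          omega
        · simp only [hjm, him, if_false, hq.adj_iff (i - m) (j - m) (by omega) (by omega)]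
          omega
  omega

/-- A triangle-free graph without chordless cycles of length at least four is a forest. -/
lemma IsLChordal.isAcyclic (hG : G.IsLChordal 3)
    (htri : ∀ a b c, G.Adj a b → G.Adj b c → ¬ G.Adj a c) : G.IsAcyclic := by
  rw [isAcyclic_iff_forall_adj_isBridge]
  intro a b hab
  rw [isBridge_iff]
  intro hr
  obtain ⟨d, q, h0, hd, hq⟩ := hr.exists_induced_path
  have hadj : ∀ i j, i < j → j < d + 1 →
      (G.Adj (q i) (q j) ↔ j = i + 1 ∨ i = 0 ∧ j + 1 = d + 1) := by
    intro i j hij hj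
    have h1 := hq.adj_iff i j hij hj
    by_cases he : s(q i, q j) = s(a, b)
    · have : G.Adj (q i) (q j) := by
        rw [← mem_edgeSet, he]; exact hab
      simp only [this, true_iff]
      rw [← h0, ← hd, Sym2.eq_iff] at he
      have hinj : ∀ x y, x ≤ d → y ≤ d → q x = q y → x = y := by
        intro x y hx hy hxy
        rcases lt_trichotomy x y with h | h | h
        · exact absurd hxy (hq.ne x y h (by omega))
        · exact h
        · exact absurd hxy.symm (hq.ne y x h (by omega))
      rcases he with ⟨e1, e2⟩ | ⟨e1, e2⟩
      · have := hinj _ _ (by omega) (by omega) e1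
        have := hinj _ _ (by omega) (by omega) e2
        omega
      · have := hinj _ _ (by omega) (by omega) e1
        have := hinj _ _ (by omega) (by omega) e2
        omega
    · have h2 : (G.deleteEdges {s(a, b)}).Adj (q i) (q j) ↔ G.Adj (q i) (q j) := by
        rw [deleteEdges_adj]; simp only [Set.mem_singleton_iff, he, not_false_eq_true, and_true]
      rw [← h2, h1]
      constructor
      · exact Or.inl
      · rintro (h | ⟨rfl, h⟩)
        · exact h
        · obtain rfl : j = d := by omega
          exact absurd (by rw [h0, hd]) he
  have hd0 : d ≠ 0 := by
    rintro rfl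
    exact hab.ne (h0.symm.trans hd)
  have hd1 : d ≠ 1 := by
    rintro rfl
    have := (hq.adj_iff 0 1 (by omega) (by omega)).2 rfl
    rw [h0, hd, deleteEdges_adj] at this
    exact this.2 rfl
  have hd2 : d ≠ 2 := by
    rintro rfl
    exact htri (q 0) (q 1) (q 2) ((hadj 0 1 (by omega) (by omega)).2 (by omega))
      ((hadj 1 2 (by omega) (by omega)).2 (by omega)) ((hadj 0 2 (by omega) (by omega)).2 (by omega))
  have := hG.le_of_induced_cycle (n := d + 1) (by omega) q hq.ne hadj
  omega

/-! ### Pursuit along induced paths -/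

lemma IsInducedPath.mono {p : ℕ → V} {m m' : ℕ} (hp : G.IsInducedPath p m) (h : m' ≤ m) :
    G.IsInducedPath p m' :=
  ⟨fun i j hij hj => hp.ne i j hij (by omega), fun i j hij hj => hp.adj_iff i j hij (by omega)⟩

lemma IsInducedPath.tail {p : ℕ → V} {m : ℕ} (hp : G.IsInducedPath p (m + 1)) :
    G.IsInducedPath (fun i => p (i + 1)) m :=
  ⟨fun i j hij hj => hp.ne (i + 1) (j + 1) (by omega) (by omega), fun i j hij hj => by
    rw [hp.adj_iff (i + 1) (j + 1) (by omega) (by omega)]; omega⟩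

lemma IsInducedPath.cons {p : ℕ → V} {m : ℕ} (hp : G.IsInducedPath p m) {u : V}
    (hu : ∀ i < m, p i ≠ u) (hup : ∀ i < m, (G.Adj (p i) u ↔ i = 0)) :
    G.IsInducedPath (fun i => if i = 0 then u else p (i - 1)) (m + 1) := by
  refine ⟨fun i j hij hj => ?_, fun i j hij hj => ?_⟩
  · have hj0 : j ≠ 0 := by omega
    by_cases hi : i = 0
    · simpa [hi, hj0] using (hu (j - 1) (by omega)).symm
    · simpa [hi, hj0] using hp.ne (i - 1) (j - 1) (by omega) (by omega)
  · have hj0 : j ≠ 0 := by omega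
    by_cases hi : i = 0
    · simp only [hi, hj0, if_true, if_false, G.adj_comm u, hup (j - 1) (by omega)]
      omega
    · simp only [hi, hj0, if_false, hp.adj_iff (i - 1) (j - 1) (by omega) (by omega)]
      omega

/-- In an `l`-chordal graph, no family `M` of pairwise intersecting sets, closed under supersets,
can escape from the closed neighbourhood of every induced path with at most `l - 2` vertices
outside a set `X` that some member of `M` avoids.

Take an induced path and a member `K` of `M` that is a component of what remains after deleting
`X` and the closed neighbourhood of the path, with first `K` and then the path as small as
possible. Then each end of the path has a neighbour `u ∉ X` attached to `K` and to no other vertex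
of the path. Put `u` in front of the path, and drop the last vertex if the path becomes too long:
since a long induced cycle is excluded, the new path still dominates the neighbourhood of `K`, and
so the member of `M` that avoids it is properly contained in `K`. -/
theorem IsLChordal.false_of_escape [Finite V] {l : ℕ} (hG : G.IsLChordal l) (hl : 3 ≤ l)
    {M : Set (Set V)} {X : Set V} (hmono : ∀ K ∈ M, ∀ K', K ⊆ K' → K' ∈ M)
    (hinter : ∀ K ∈ M, ∀ K' ∈ M, (K ∩ K').Nonempty) (hX : ∃ K ∈ M, Disjoint K X)
    (hpath : ∀ (p : ℕ → V) (m : ℕ), 1 ≤ m → m + 2 ≤ l → G.IsInducedPath p m →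
      (∀ i < m, p i ∉ X) → ∃ K ∈ M, (G.induce K).Connected ∧ Disjoint K X ∧
        ∀ i < m, p i ∉ K ∧ p i ∉ G.extNbhd K) : False := by
  let State : ℕ → ℕ → Prop := fun n m => ∃ (p : ℕ → V) (K : Set V),
    (1 ≤ m ∧ m + 2 ≤ l ∧ G.IsInducedPath p m ∧ ∀ i < m, p i ∉ X) ∧
    (K ∈ M ∧ (G.induce K).Connected ∧ Disjoint K X) ∧
    (∀ i < m, p i ∉ K ∧ p i ∉ G.extNbhd K) ∧
    (∀ v ∈ G.extNbhd K, v ∉ X → ∃ i < m, G.Adj (p i) v) ∧ K.ncard = n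
  -- a path that dominates the neighbourhood of `L` and meets or touches `L` leads into `L`
  have step : ∀ (p : ℕ → V) (m : ℕ) (L : Set V), 1 ≤ m → m + 2 ≤ l → G.IsInducedPath p m →
      (∀ i < m, p i ∉ X) → L ∈ M →
      (∀ v ∈ G.extNbhd L, v ∉ X → ∃ i < m, v = p i ∨ G.Adj (p i) v) →
      (∃ x ∈ L, ∃ i < m, x = p i ∨ G.Adj (p i) x) → ∃ n < L.ncard, State n m := by
    intro p m L hm hml hp hpX hL hdom ⟨x, hxL, i₀, hi₀, hx⟩
    obtain ⟨K', hK'M, hK'c, hK'X, hK'p⟩ := hpath p m hm hml hp hpX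
    set Z : Set V := {v | v ∉ X ∧ ∀ i < m, v ≠ p i ∧ ¬ G.Adj (p i) v} with hZ
    have hK'Z : K' ⊆ Z := by
      intro v hv
      refine ⟨fun hvX => Set.disjoint_left.1 hK'X hv hvX, fun i hi => ⟨?_, fun hadj => ?_⟩⟩
      · rintro rfl
        exact (hK'p i hi).1 hv
      · exact (hK'p i hi).2 ⟨(hK'p i hi).1, v, hv, hadj.symm⟩
    obtain ⟨K, hK, hK'K⟩ := exists_isComponentIn hK'c hK'Z
    have hKM := hmono K' hK'M K hK'K
    have hKL : K ⊆ L := by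
      refine hK.connected.subset_of_disjoint_extNbhd (hinter K hKM L hL) fun v hv hvK => ?_
      have hvZ := hK.subset hvK
      obtain ⟨i, hi, h⟩ := hdom v hv hvZ.1
      rcases h with h | h
      · exact (hvZ.2 i hi).1 h
      · exact (hvZ.2 i hi).2 h
    have hxK : x ∉ K := by
      intro hxK
      have hxZ := (hK.subset hxK).2 i₀ hi₀
      exact hx.elim hxZ.1 hxZ.2
    have hpK : ∀ i < m, p i ∉ K ∧ p i ∉ G.extNbhd K := by
      refine fun i hi => ⟨fun h => ((hK.subset h).2 i hi).1 rfl, ?_⟩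
      rintro ⟨-, v, hv, hadj⟩
      exact ((hK.subset hv).2 i hi).2 hadj.symm
    refine ⟨K.ncard, Set.ncard_lt_ncard ⟨hKL, fun h => hxK (h hxL)⟩, p, K, ⟨hm, hml, hp, hpX⟩,
      ⟨hKM, hK.connected, Set.disjoint_left.2 fun v hv => (hK.subset hv).1⟩, hpK, ?_, rfl⟩
    intro v hv hvX
    by_contra! hno
    refine hK.notMem_of_mem_extNbhd v hv ⟨hvX, fun i hi => ⟨?_, hno i hi⟩⟩
    rintro rfl
    exact (hpK i hi).2 hv
  have nonempty : ∀ K ∈ M, K.Nonempty := fun K hK => (hinter K hK K hK).mono Set.inter_subset_left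
  have const : ∀ x ∉ X, ∀ K ∈ M, x ∈ K →
      (∀ v ∈ G.extNbhd K, v ∉ X → ∃ i < 1, v = x ∨ G.Adj x v) →
      ∃ n < K.ncard, State n 1 := fun x hx K hK hxK hdom =>
    step (fun _ => x) 1 K le_rfl (by omega) ⟨by omega, by omega⟩ (fun _ _ => hx) hK hdom
      ⟨x, hxK, 0, by omega, Or.inl rfl⟩
  have noState : ∀ n m, ¬ State n m := by
    intro n
    induction n using Nat.strong_induction_on with
    | _ n ihn =>
    intro m
    induction m with
    | zero =>
      rintro ⟨p, K, ⟨hm, -⟩, -⟩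
      omega
    | succ m ihm =>
      rintro ⟨p, K, ⟨hm, hml, hp, hpX⟩, ⟨hKM, hKc, hKX⟩, hpK, hdom, rfl⟩
      by_cases hKN : ∃ v ∈ G.extNbhd K, v ∉ X
      swap
      · push Not at hKN
        obtain ⟨x, hx⟩ := nonempty K hKM
        obtain ⟨n', hn', hs⟩ := const x (Set.disjoint_left.1 hKX hx) K hKM hx
          fun v hv hvX => absurd (hKN v hv) hvX
        exact ihn n' hn' _ hs
      -- neighbours of `K` attached only to the first, respectively the last vertex of the path
      obtain ⟨u, hu, huX, hup⟩ : ∃ u ∈ G.extNbhd K, u ∉ X ∧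
          ∀ i < m + 1, (G.Adj (p i) u ↔ i = 0) := by
        by_contra! hno
        have hdom' : ∀ v ∈ G.extNbhd K, v ∉ X → ∃ i < m, G.Adj (p (i + 1)) v := by
          intro v hv hvX
          obtain ⟨i, hi, h⟩ := hno v hv hvX
          obtain ⟨j, hj, hjv⟩ := hdom v hv hvX
          by_contra! hno'
          have hlast : ∀ i < m + 1, G.Adj (p i) v → i = 0 := by
            intro i hi hiv
            by_contra hi0
            have := hno' (i - 1) (by omega)
            rw [Nat.sub_add_cancel (by omega)] at this
            exact this hiv
          obtain rfl := hlast j hj hjv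
          rcases h with ⟨h1, h2⟩ | ⟨h1, rfl⟩
          · exact h2 (hlast i hi h1)
          · exact h1 hjv
        have hm0 : m ≠ 0 := by
          rintro rfl
          obtain ⟨v, hv, hvX⟩ := hKN
          obtain ⟨i, hi, -⟩ := hdom' v hv hvX
          omega
        exact ihm ⟨fun i => p (i + 1), K, ⟨by omega, by omega, hp.tail, fun i hi =>
          hpX (i + 1) (by omega)⟩, ⟨hKM, hKc, hKX⟩, fun i hi => hpK (i + 1) (by omega), hdom', rfl⟩
      have hneu : ∀ i < m + 1, p i ≠ u := fun i hi h => (hpK i hi).2 (h ▸ hu)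
      have hcons := hp.cons hneu hup
      have hconsX : ∀ i < m + 2, (if i = 0 then u else p (i - 1)) ∉ X := by
        intro i hi
        by_cases h0 : i = 0
        · simpa [h0] using huX
        · simpa [h0] using hpX (i - 1) (by omega)
      obtain ⟨x, hxK, hxu⟩ := hu.2
      obtain ⟨m', hm', hm'l, hdom'⟩ : ∃ m', (1 ≤ m' ∧ m' ≤ m + 2) ∧ m' + 2 ≤ l ∧
          ∀ v ∈ G.extNbhd K, v ∉ X → ∃ i < m', v = (if i = 0 then u else p (i - 1)) ∨
            G.Adj (if i = 0 then u else p (i - 1)) v := by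
        by_cases hml' : m + 4 ≤ l
        · refine ⟨m + 2, by omega, hml', fun v hv hvX => ?_⟩
          obtain ⟨i, hi, hiv⟩ := hdom v hv hvX
          exact ⟨i + 1, by omega, Or.inr (by simpa using hiv)⟩
        · refine ⟨m + 1, by omega, hml, fun v hv hvX => ?_⟩
          by_cases hv' : ∃ i < m, G.Adj (p i) v
          · obtain ⟨i, hi, hiv⟩ := hv'
            exact ⟨i + 1, by omega, Or.inr (by simpa using hiv)⟩
          refine ⟨0, by omega, ?_⟩
          rw [if_pos rfl]
          by_contra! hno
          have := hG.add_three_le hp (by omega) hKc hpK hu hv hno.1.symm hno.2 hup ?_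
          · omega
          · push Not at hv'
            obtain ⟨j, hj, hjv⟩ := hdom v hv hvX
            have hjm : j = m := by
              by_contra hne
              exact hv' j (by omega) hjv
            subst hjm
            intro i hi
            constructor
            · intro hiv
              by_contra hne
              exact hv' i (by omega) hiv
            · intro h
              obtain rfl : i = j := by omega
              exact hjv
      obtain ⟨n', hn', hs⟩ := step _ m' K hm'.1 hm'l (hcons.mono hm'.2)
        (fun i hi => hconsX i (by omega)) hKM hdom'
        ⟨x, hxK, 0, by omega, Or.inr (by simpa using hxu.symm)⟩
      exact ihn n' hn' _ hs
  obtain ⟨K, hKM, hKX⟩ := hX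
  obtain ⟨x, hx⟩ := nonempty K hKM
  have hM : Set.univ ∈ M := hmono K hKM _ (Set.subset_univ K)
  obtain ⟨n, -, hs⟩ := const x (Set.disjoint_left.1 hKX hx) Set.univ hM trivial
    fun v hv => absurd trivial hv.1
  exact noState n 1 hs

/-! ### Guarded vertices -/

/-- The set `S` guards the vertex `v` against `M`: a connected member of `M` disjoint from `S`
neither contains `v` nor has `v` as a neighbour. -/
def IsGuard (G : SimpleGraph V) (M : Set (Set V)) (S : Set V) (v : V) : Prop :=
  ∀ K ∈ M, (G.induce K).Connected → Disjoint K S → v ∉ K ∧ v ∉ G.extNbhd K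

/-- A set guarding `v` also guards the neighbours of `v` outside it. -/
lemma IsGuard.of_adj {M : Set (Set V)} (hmono : ∀ K ∈ M, ∀ K', K ⊆ K' → K' ∈ M) {S : Set V}
    {v w : V} (h : G.IsGuard M S v) (hvw : G.Adj v w) (hw : w ∉ S) : G.IsGuard M S w := by
  intro K hK hKc hKS
  have hv := h K hK hKc hKS
  refine ⟨fun hwK => hv.2 ⟨hv.1, w, hwK, hvw.symm⟩, fun hwN => ?_⟩
  have hc : (G.induce (K ∪ {w})).Connected :=
    hKc.induce_union_of_subset_extNbhd (by simpa using hwN)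
  have hv' := h (K ∪ {w}) (hmono K hK _ Set.subset_union_left) hc
    (Set.disjoint_union_left.2 ⟨hKS, by simpa using hw⟩)
  exact hv'.2 ⟨hv'.1, w, Or.inr rfl, hvw.symm⟩

lemma ncard_biUnion_le_card_mul [Finite V] {ι : Type*} (s : Finset ι) (S : ι → Set V) {r : ℕ}
    (h : ∀ i ∈ s, (S i).ncard ≤ r) : (⋃ i ∈ s, S i).ncard ≤ s.card * r := by
  classical
  induction s using Finset.induction_on with
  | empty => simp
  | insert a s ha ih =>
    rw [Finset.set_biUnion_insert, Finset.card_insert_of_notMem ha, Nat.add_mul, one_mul]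
    have h1 := Set.ncard_union_le (S a) (⋃ i ∈ s, S i)
    have h2 := h a (Finset.mem_insert_self a s)
    have h3 := ih fun i hi => h i (Finset.mem_insert_of_mem hi)
    omega

/-- A haven escapes from the closed neighbourhood of a path of guarded vertices, since it suffices
to delete the guards. For a path with at least two vertices one deletion can be saved: either the
guard of the first vertex also guards the second, or it contains the second vertex, which need not
be deleted because it has a guard of its own. -/
lemma IsHaven.exists_avoiding_path [Finite V] {M : Set (Set V)} {q r m : ℕ} (hM : G.IsHaven q M)
    {X : Set V} (hX : X.ncard ≤ r) (hr : 1 ≤ r)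
    (hguard : ∀ v ∉ X, ∃ S : Set V, S.ncard ≤ r ∧ v ∉ S ∧ G.IsGuard M S v) {p : ℕ → V}
    (hp : G.IsInducedPath p m) (hpX : ∀ i < m, p i ∉ X)
    (hq : (m + 1) * r ≤ q ∨ 2 ≤ m ∧ (m + 1) * r ≤ q + 1) :
    ∃ K ∈ M, (G.induce K).Connected ∧ Disjoint K X ∧ ∀ i < m, p i ∉ K ∧ p i ∉ G.extNbhd K := by
  classical
  have hg : ∀ i, ∃ S : Set V, S.ncard ≤ r ∧
      (i < m → p i ∉ S ∧ G.IsGuard M S (p i)) := by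
    intro i
    by_cases hi : i < m
    · obtain ⟨S, h1, h2, h3⟩ := hguard (p i) (hpX i hi)
      exact ⟨S, h1, fun _ => ⟨h2, h3⟩⟩
    · exact ⟨∅, by simp, fun h => absurd h hi⟩
  choose S hSr hS using hg
  have hcard : ∀ s : Finset ℕ, (X ∪ ⋃ i ∈ s, S i).ncard ≤ (s.card + 1) * r := by
    intro s
    have h1 := Set.ncard_union_le X (⋃ i ∈ s, S i)
    have h2 := ncard_biUnion_le_card_mul s S fun i _ => hSr i
    rw [Nat.add_mul, one_mul]
    omega
  rcases hq with hq | ⟨hm, hq⟩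
  · obtain ⟨K, hK, hKc, hKQ⟩ := hM.exists_connected (X ∪ ⋃ i ∈ Finset.range m, S i)
      ((hcard _).trans (by simpa using hq))
    refine ⟨K, hK, hKc, hKQ.mono_right Set.subset_union_left, fun i hi => ?_⟩
    refine (hS i hi).2 K hK hKc (hKQ.mono_right ?_)
    exact (Set.subset_biUnion_of_mem (u := S) (by simpa using hi)).trans Set.subset_union_right
  have h01 : G.Adj (p 0) (p 1) := (hp.adj_iff 0 1 (by omega) (by omega)).2 rfl
  by_cases h1 : p 1 ∈ S 0
  · have hlt : ((X ∪ ⋃ i ∈ Finset.range m, S i) \ {p 1}).ncard ≤ q := by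
      have hmem : p 1 ∈ X ∪ ⋃ i ∈ Finset.range m, S i :=
        Or.inr (Set.mem_iUnion₂.2 ⟨0, Finset.mem_range.2 (by omega), h1⟩)
      rw [Set.ncard_sdiff_singleton_of_mem hmem]
      have := hcard (Finset.range m)
      rw [Finset.card_range] at this
      omega
    obtain ⟨K, hK, hKc, hKQ⟩ := hM.exists_connected _ hlt
    have hKQ' : ∀ T ⊆ X ∪ ⋃ i ∈ Finset.range m, S i, p 1 ∉ T → Disjoint K T := fun T hT h =>
      hKQ.mono_right (Set.subset_sdiff_singleton hT h)
    have hSsub : ∀ i < m, S i ⊆ X ∪ ⋃ i ∈ Finset.range m, S i := fun i hi =>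
      (Set.subset_biUnion_of_mem (u := S) (by simpa using hi)).trans Set.subset_union_right
    have hp1 : p 1 ∉ K := ((hS 1 (by omega)).2 K hK hKc
      (hKQ' _ (hSsub 1 (by omega)) (hS 1 (by omega)).1)).1
    have hdisj : Disjoint K (X ∪ ⋃ i ∈ Finset.range m, S i) := by
      refine Set.disjoint_left.2 fun x hx hxQ => Set.disjoint_left.1 hKQ hx ⟨hxQ, ?_⟩
      rintro rfl
      exact hp1 hx
    exact ⟨K, hK, hKc, hdisj.mono_right Set.subset_union_left, fun i hi =>
      (hS i hi).2 K hK hKc (hdisj.mono_right (hSsub i hi))⟩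
  · have hle : (X ∪ ⋃ i ∈ (Finset.range m).erase 1, S i).ncard ≤ q := by
      refine (hcard _).trans ?_
      rw [Finset.card_erase_of_mem (by simp; omega), Finset.card_range,
        Nat.sub_add_cancel (by omega)]
      rw [Nat.add_mul] at hq
      omega
    obtain ⟨K, hK, hKc, hKQ⟩ := hM.exists_connected _ hle
    refine ⟨K, hK, hKc, hKQ.mono_right Set.subset_union_left, fun i hi => ?_⟩
    have hdisj : ∀ j < m, j ≠ 1 → Disjoint K (S j) := fun j hj hj1 => hKQ.mono_right
      ((Set.subset_biUnion_of_mem (u := S) (Finset.mem_erase.2 ⟨hj1, Finset.mem_range.2 hj⟩)).trans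
        Set.subset_union_right)
    by_cases hi1 : i = 1
    · subst hi1
      exact (hS 0 (by omega)).2.of_adj hM.mono h01 h1 K hK hKc (hdisj 0 (by omega) (by omega))
    · exact (hS i hi).2 K hK hKc (hdisj i hi hi1)

/-! ### Separations and blocks -/

lemma Connected.subset_or_subset_of_isSeparation {A B K : Set V} (hAB : G.IsSeparation A B)
    (hK : (G.induce K).Connected) (hKAB : Disjoint K (A ∩ B)) : K ⊆ A \ B ∨ K ⊆ B \ A := by
  by_cases h : (K ∩ (A \ B)).Nonempty
  · refine Or.inl (hK.subset_of_disjoint_extNbhd h ?_)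
    rintro v ⟨hv, u, hu, huv⟩ hvK
    have hvA : v ∈ A ∪ B := hAB.1 ▸ trivial
    have h1 : v ∉ A ∩ B := Set.disjoint_left.1 hKAB hvK
    refine hAB.2 u hu v ⟨?_, ?_⟩ huv
    · by_contra hvB
      exact hv ⟨hvA.resolve_right hvB, hvB⟩
    · intro hvA'
      by_cases hvB : v ∈ B
      · exact h1 ⟨hvA', hvB⟩
      · exact hv ⟨hvA', hvB⟩
  · refine Or.inr fun v hvK => ?_
    have hvA : v ∈ A ∪ B := hAB.1 ▸ trivial
    have h1 : v ∉ A ∩ B := Set.disjoint_left.1 hKAB hvK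
    have h2 : v ∉ A \ B := fun hv => h ⟨v, hvK, hv⟩
    by_cases hv : v ∈ A
    · by_cases hvB : v ∈ B
      · exact absurd ⟨hv, hvB⟩ h1
      · exact absurd ⟨hv, hvB⟩ h2
    · exact ⟨hvA.resolve_left hv, hv⟩

/-- The vertex `v` can be separated from the haven `M` by at most `r` vertices. -/
def IsSeparableFrom (G : SimpleGraph V) (M : Set (Set V)) (r : ℕ) (v : V) : Prop :=
  ∃ A B : Set V, G.IsSeparation A B ∧ (A ∩ B).ncard ≤ r ∧ v ∈ A \ B ∧ ∃ K ∈ M, K ⊆ B \ A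

lemma IsSeparableFrom.exists_isGuard {M : Set (Set V)}
    (hinter : ∀ K ∈ M, ∀ K' ∈ M, (K ∩ K').Nonempty) {r : ℕ} {v : V}
    (h : G.IsSeparableFrom M r v) : ∃ S : Set V, S.ncard ≤ r ∧ v ∉ S ∧ G.IsGuard M S v := by
  obtain ⟨A, B, hAB, hr, hv, K₀, hK₀, hK₀B⟩ := h
  refine ⟨A ∩ B, hr, fun h => hv.2 h.2, fun K hK hKc hKS => ?_⟩
  have hKB : K ⊆ B \ A := by
    refine (hKc.subset_or_subset_of_isSeparation hAB hKS).resolve_left fun hKA => ?_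
    obtain ⟨x, hx, hx₀⟩ := hinter K hK K₀ hK₀
    exact (hKA hx).2 (hK₀B hx₀).1
  refine ⟨fun hvK => (hKB hvK).2 hv.1, ?_⟩
  rintro ⟨-, u, hu, huv⟩
  exact hAB.2 v hv u (hKB hu) huv.symm

/-- The vertices that cannot be separated from a haven cannot be separated from each other: the
haven lies on one side of a separation, and hence is separated from the vertices on the other. -/
lemma IsHaven.isInseparable [Finite V] {M : Set (Set V)} {q r : ℕ} (hM : G.IsHaven q M)
    (hr : r ≤ q) : G.IsInseparable (r + 1) {v | ¬ G.IsSeparableFrom M r v} := by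
  intro A B hAB hlt
  have hle : (A ∩ B).ncard ≤ r := by
    rw [← (Set.toFinite (A ∩ B)).cast_ncard_eq] at hlt
    exact Nat.lt_succ_iff.1 (by exact_mod_cast hlt)
  obtain ⟨K, hK, hKc, hKS⟩ := hM.exists_connected (A ∩ B) (hle.trans hr)
  have hunion : ∀ v, v ∈ A ∪ B := fun v => hAB.1 ▸ trivial
  rcases hKc.subset_or_subset_of_isSeparation hAB hKS with hKA | hKB
  · refine Or.inl fun v hv => ?_
    by_contra hvA
    refine hv ⟨B, A, ⟨by rw [Set.union_comm]; exact hAB.1, fun b hb a ha h => hAB.2 a ha b hb h.symm⟩,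
      by rwa [Set.inter_comm], ⟨(hunion v).resolve_left hvA, hvA⟩, K, hK, hKA⟩
  · refine Or.inr fun v hv => ?_
    by_contra hvB
    exact hv ⟨A, B, hAB, hle, ⟨(hunion v).resolve_right hvB, hvB⟩, K, hK, hKB⟩

lemma isInseparable_of_pairwise_adj {X : Set V} (k : ℕ)
    (hX : ∀ x ∈ X, ∀ y ∈ X, x ≠ y → G.Adj x y) : G.IsInseparable k X := by
  intro A B hAB _
  by_contra! h
  obtain ⟨⟨x, hx, hxA⟩, y, hy, hyB⟩ := And.intro (Set.not_subset.1 h.1) (Set.not_subset.1 h.2)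
  have hx' : x ∈ A ∪ B := hAB.1 ▸ trivial
  have hy' : y ∈ A ∪ B := hAB.1 ▸ trivial
  have hxB := hx'.resolve_left hxA
  refine hAB.2 y ⟨hy'.resolve_right hyB, hyB⟩ x ⟨hxB, hxA⟩ (hX y hy x hx ?_)
  rintro rfl
  exact hyB hxB

/-- An inseparable set of at least `k` vertices extends to a `k`-block. -/
lemma IsInseparable.exists_isBlock [Finite V] {k : ℕ} {X : Set V} (hX : G.IsInseparable k X)
    (hk : k ≤ X.ncard) : ∃ Y, G.IsBlock k Y := by
  obtain ⟨Y, hXY, hY⟩ := (Set.toFinite {Y | G.IsInseparable k Y}).exists_le_maximal (a := X) hX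
  refine ⟨Y, ?_, hY⟩
  rw [← (Set.toFinite Y).cast_ncard_eq]
  exact_mod_cast hk.trans (Set.ncard_le_ncard hXY)

/-- An `l`-chordal graph with a haven of large enough order has a set of more than `r` vertices
that no separation of order at most `r` splits. -/
theorem IsLChordal.exists_isInseparable [Finite V] {l q r : ℕ} (hG : G.IsLChordal l) (hl : 3 ≤ l)
    (hr : 1 ≤ r) {M : Set (Set V)} (hM : G.IsHaven q M)
    (hq : (l - 1) * r ≤ q ∨ 4 ≤ l ∧ (l - 1) * r ≤ q + 1) :
    ∃ X, G.IsInseparable (r + 1) X ∧ r + 1 ≤ X.ncard := by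
  have hlr : 2 * r ≤ (l - 1) * r := Nat.mul_le_mul_right r (by omega)
  refine ⟨_, hM.isInseparable (r := r) (by omega), ?_⟩
  by_contra! hlt
  set X := {v | ¬ G.IsSeparableFrom M r v} with hXdef
  have hX : X.ncard ≤ r := by omega
  obtain ⟨K₀, hK₀, -, hK₀X⟩ := hM.exists_connected X (by omega)
  refine hG.false_of_escape hl hM.mono hM.inter_nonempty ⟨K₀, hK₀, hK₀X⟩ ?_
  intro p m hm hml hp hpX
  refine hM.exists_avoiding_path hX hr (fun v hv => ?_) hp hpX ?_
  · exact (not_not.1 hv : G.IsSeparableFrom M r v).exists_isGuard hM.inter_nonempty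
  · rcases hq with hq | ⟨hl4, hq⟩
    · exact Or.inl ((Nat.mul_le_mul_right r (by omega)).trans hq)
    · rcases Nat.lt_or_ge (m + 2) l with hlt' | hge
      · left
        have h1 : (m + 2) * r ≤ (l - 1) * r := Nat.mul_le_mul_right r (by omega)
        have h2 : (m + 2) * r = (m + 1) * r + r := by ring
        omega
      · exact Or.inr ⟨by omega, (Nat.mul_le_mul_right r (by omega)).trans hq⟩

end SimpleGraph

theorem lemma3 (l k t : ℕ) (hl : 3 ≤ l) (hk : 1 ≤ k) (ht : 1 ≤ t)
    (hlkt : 2 * ((l : ℤ) - 2) * ((k : ℤ) - 1) ^ 2 ≤ (t : ℤ))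
    {V : Type*} [Finite V] (G : SimpleGraph V)
    (hG : G.IsLChordal l) (htw : t ≤ G.treeWidth) :
    ∃ X : Set V, G.IsBlock k X := by
  obtain ⟨r, rfl⟩ : ∃ r, k = r + 1 := ⟨k - 1, by omega⟩
  obtain ⟨a, rfl⟩ : ∃ a, l = a + 3 := ⟨l - 3, by omega⟩
  have hbound : 2 * (a + 1) * r ^ 2 ≤ t := by
    have : (2 * (a + 1) * r ^ 2 : ℤ) ≤ t := by
      convert hlkt using 2
      · push_cast; ring
      · push_cast; ring
    exact_mod_cast this
  by_contra hno
  have hsmall : ∀ X : Set V, G.IsInseparable (r + 1) X → X.ncard ≤ r := by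
    intro X hX
    by_contra! hlt
    exact hno (hX.exists_isBlock hlt)
  have hclique : ∀ X : Set V, (∀ x ∈ X, ∀ y ∈ X, x ≠ y → G.Adj x y) → X.ncard ≤ r :=
    fun X hX => hsmall X (SimpleGraph.isInseparable_of_pairwise_adj _ hX)
  rcases Nat.eq_zero_or_pos r with rfl | hr
  · have hempty : (Set.univ : Set V) = ∅ := by
      by_contra hne
      obtain ⟨v, -⟩ := Set.nonempty_iff_ne_empty.2 hne
      have := hclique {v} (by rintro x rfl y rfl h; exact absurd rfl h)
      simp at this
    have : G.treeWidth ≤ 0 :=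
      SimpleGraph.HasRootedDecomposition.treeWidth_le (R := Set.univ) (.of_ncard_le (by simp [hempty]))
    omega
  -- here `1 ≤ r`, so `2 ≤ t`
  have hacyclic : ¬ G.IsAcyclic := by
    intro h
    have h1 := h.treeWidth_le_one
    have h2 : 1 * 1 ≤ (a + 1) * r ^ 2 := Nat.mul_le_mul (by omega) (Nat.one_le_pow _ _ hr)
    have h3 : 2 * (a + 1) * r ^ 2 = 2 * ((a + 1) * r ^ 2) := by ring
    omega
  rcases eq_or_ne r 1 with rfl | hr1
  · refine hacyclic (SimpleGraph.isAcyclic_iff_forall_adj_isBridge.2 fun v w hvw => ?_)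
    have := hclique {v, w} (by
      rintro x (rfl | rfl) y (rfl | rfl) h <;> first | exact absurd rfl h | exact hvw | exact hvw.symm)
    rw [Set.ncard_pair hvw.ne] at this
    omega
  by_cases hexc : a = 0 ∧ r = 2
  · obtain ⟨rfl, rfl⟩ := hexc
    refine hacyclic (hG.isAcyclic fun x y z hxy hyz hxz => ?_)
    have := hclique {x, y, z} (by
      rintro b (rfl | rfl | rfl) c (rfl | rfl | rfl) h <;>
        first | exact absurd rfl h | assumption | exact SimpleGraph.Adj.symm (by assumption))
    rw [Set.ncard_eq_three.2 ⟨x, y, z, hxy.ne, hxz.ne, hyz.ne, rfl⟩] at this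
    omega
  -- `q = 2 * r` if `l = 3`, where `3 ≤ r`, and `q = (l - 1) * r - 1` otherwise
  obtain ⟨q, hq1, hqt, hq⟩ : ∃ q, 1 ≤ q ∧ 3 * q ≤ t + 1 ∧
      ((a + 3 - 1) * r ≤ q ∨ 4 ≤ a + 3 ∧ (a + 3 - 1) * r ≤ q + 1) := by
    rcases Nat.eq_zero_or_pos a with rfl | ha
    · refine ⟨2 * r, by omega, ?_, Or.inl (by omega)⟩
      obtain ⟨b, rfl⟩ : ∃ b, r = b + 3 := ⟨r - 3, by omega⟩
      nlinarith
    · obtain ⟨a, rfl⟩ : ∃ a', a = a' + 1 := ⟨a - 1, by omega⟩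
      obtain ⟨b, rfl⟩ : ∃ b, r = b + 2 := ⟨r - 2, by omega⟩
      refine ⟨a * b + 2 * a + 3 * b + 5, by omega, ?_, Or.inr ⟨by omega, ?_⟩⟩
      · have h1 : 2 * (a + 1 + 1) * (b + 2) ^ 2 =
            2 * (a * b ^ 2) + 8 * (a * b) + 8 * a + 4 * b ^ 2 + 16 * b + 16 := by ring
        have h2 := Nat.zero_le (a * b ^ 2)
        omega
      · have h1 : (a + 1 + 3 - 1) * (b + 2) = a * b + 2 * a + 3 * b + 6 := by
          rw [show a + 1 + 3 - 1 = a + 3 by omega]; ring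
        omega
  obtain ⟨M, hM⟩ := SimpleGraph.exists_isHaven hq1 hqt htw
  obtain ⟨X, hX, hXr⟩ := hG.exists_isInseparable hl hr hM hq
  have := hsmall X hX
  omega
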